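/- **Theorem 5.1.** Let $t_0<T$, let $n\ge j\ge 2$ be integers, and let $a_0,a_1,\dots,a_n$ be real-valued continuous functions on $[t_0,T]$. Consider the equation $$y'+\sum_{k=0}^{n}a_k(t)\,y^k=0,\qquad t\in[t_0,T]. \tag{1.1}$$ A solution $y$ of (1.1) on $[t_0,T]$ is called *closed* if $y(t_0)=y(T)$. A closed solution $y$ is called *isolated* if there is $\varepsilon>0$ such that every closed solution $z$ of (1.1) on $[t_0,T]$ with $|z(t_0)-y(t_0)|<\varepsilon$ coincides with $y$ on $[t_0,T]$. Assume: 1. $a_k(t)\ge 0$ for $k=j,\dots,n$ and $\sum_{k=j}^{n}a_k(t)>0$, for all $t\in[t_0,T]$; 2. for some real number $M\ge M_{T,j}$, where $$M_{T,j}=\max\Bigl\{1,\ \max_{\tau\in[t_0,T]}\frac{\sum_{k=0}^{j-1}|a_k(\tau)|}{\sum_{k=j}^{n}a_k(\tau)}\Bigr\},$$ one has, with $a_k^+=\max\{0,a_k\}$, $$\int_{t_0}^{t}\exp\Bigl\{\int_{t_0}^{\tau}\Bigl[\sum_{k=2}^{n}a_k^+(s)M^{k-1}+a_1(s)\Bigr]ds\Bigr\}\,a_0(\tau)\,d\tau\le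 0\qquad\text{for all } t\in[t_0,T].$$ Then there is a closed solution $y_*$ of (1.1) on $[t_0,T]$ such that: - ($\alpha$) $y_*(t)\ge 0$ for all $t\in[t_0,T]$; - ($\beta$) if $a_0\not\equiv 0$ and $a_0(t)\le 0$ for all $t\in[t_0,T]$, then $y_*(t)>0$ for all $t\in[t_0,T]$; - ($\gamma$) if $j=2$ and $\int_{t_0}^{T}a_1(\tau)\,d\tau>0$, then $y_*$ is isolated. -/

import Mathlib

open Set MeasureTheory

namespace PolyODE

/-- `y` is a solution on `[t₀, T]` of the polynomial equation `y' + ∑_{k=0}^n a_k(t) y^k = 0`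
(with one-sided derivatives at the two end points). -/
def IsSolution (n : ℕ) (a : ℕ → ℝ → ℝ) (t₀ T : ℝ) (y : ℝ → ℝ) : Prop :=
  ∀ t ∈ Icc t₀ T,
    HasDerivWithinAt y (-∑ k ∈ Finset.range (n + 1), a k t * y t ^ k) (Icc t₀ T) t

/-- A solution on `[t₀, T]` is closed if it takes the same value at both end points. -/
def IsClosedSolution (n : ℕ) (a : ℕ → ℝ → ℝ) (t₀ T : ℝ) (y : ℝ → ℝ) : Prop :=
  IsSolution n a t₀ T y ∧ y t₀ = y T

/-- A closed solution is isolated if no other closed solution on `[t₀, T]` starts near it. -/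
def IsIsolatedClosedSolution (n : ℕ) (a : ℕ → ℝ → ℝ) (t₀ T : ℝ) (y : ℝ → ℝ) : Prop :=
  IsClosedSolution n a t₀ T y ∧
    ∃ ε > 0, ∀ z : ℝ → ℝ, IsClosedSolution n a t₀ T z → |z t₀ - y t₀| < ε →
      EqOn z y (Icc t₀ T)

/-- `M_{T,j} = max {1, max_{τ ∈ [t₀,T]} (∑_{k<j} |a_k(τ)|) / (∑_{k=j}^n a_k(τ))}`. For continuous
coefficients and a positive denominator the supremum below is a maximum. -/
noncomputable def boundM (n : ℕ) (a : ℕ → ℝ → ℝ) (t₀ T : ℝ) (j : ℕ) : ℝ :=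
  max 1 (sSup ((fun τ => (∑ k ∈ Finset.range j, |a k τ|) / ∑ k ∈ Finset.Icc j n, a k τ) ''
    Icc t₀ T))

end PolyODE

/-!
The equation is truncated: in the right-hand side `y` is replaced by its projection to `[-1, M]`.
The truncated field is bounded and Lipschitz in `y`, so it has a flow on all of `[t₀, T]`, which
depends continuously on the initial value (`exists_clamped_flow`). The interval `[0, M]` is
invariant under this flow:

* by the choice of `M`, the terms of degree at least `j` outweigh the others at `y = M`, so the
  field points down there (`sum_mul_pow_nonneg`, `clamped_le`);
* for `0 ≤ y ≤ M`, the coefficient `∑_{k ≥ 1} a_k y ^ (k - 1)` of the equation, written as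
  `y' = -a₀ - (⋯) y`, is at most the rate in the exponent of the integral condition. With the
  corresponding weight `E` one gets `(E y)' ≥ -E a₀`, and the integral of the right-hand side is
  nonnegative. Exponential barriers show that `y` cannot become negative (`clamped_nonneg`).

Hence the Poincaré map of the truncated equation maps `[0, M]` continuously to itself, and a fixed
point of it is the initial value of a nonnegative closed solution of the original equation
(`exists_closed_nonneg`).

If `a₀ ≤ 0`, then `y` times an integrating factor is monotone, so a zero of `y` forces `y` to
vanish on an initial interval and, by closedness, everywhere, whence `a₀ = 0`
(`IsClosedSolution.pos`). For isolation, the difference `u` of two solutions satisfies `u' = -D u`,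
where `D` is a difference quotient of the polynomial; if the second solution starts close to `y`,
then `D` is uniformly close to the coefficient of the variational equation along `y`, which for
`j = 2` is at least `a₁`. So `D` has positive integral and `u` cannot be closed unless it vanishes
(`IsClosedSolution.isolated`).
-/

/-! ### Differential inequalities on a compact interval -/

namespace PolyODE

lemma nonpos_of_forall_le_mul {x K ε₀ : ℝ} (hK : 0 < K) (hε₀ : 0 < ε₀)
    (h : ∀ ε, 0 < ε → ε ≤ ε₀ → x ≤ ε * K) : x ≤ 0 := by
  by_contra! hx
  have h1 := h (min ε₀ (x / (2 * K))) (by positivity) (min_le_left _ _)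
  have h2 : min ε₀ (x / (2 * K)) * K ≤ x / (2 * K) * K := by
    gcongr
    exact min_le_right _ _
  have h3 : x / (2 * K) * K = x / 2 := by field_simp
  linarith

lemma hasDerivWithinAt_Ici_of_Icc {f : ℝ → ℝ} {f' t₀ T t : ℝ} (ht : t ∈ Ico t₀ T)
    (h : HasDerivWithinAt f f' (Icc t₀ T) t) : HasDerivWithinAt f f' (Ici t) t :=
  h.mono_of_mem_nhdsWithin (Icc_mem_nhdsGE_of_mem ht)

lemma hasDerivWithinAt_integral_Icc {D : ℝ → ℝ} {t₀ T t : ℝ} (hT : t₀ ≤ T)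
    (hD : ContinuousOn D (Icc t₀ T)) (ht : t ∈ Icc t₀ T) :
    HasDerivWithinAt (fun x => ∫ s in t₀..x, D s) (D t) (Icc t₀ T) t := by
  have hc : Continuous (IccExtend hT ((Icc t₀ T).domRestrict D)) :=
    hD.domRestrict.Icc_extend'
  have hE : ∀ s ∈ Icc t₀ T, IccExtend hT ((Icc t₀ T).domRestrict D) s = D s := fun s hs => by
    rw [IccExtend_of_mem _ _ hs, domRestrict_apply]
  have h := (hc.integral_hasStrictDerivAt t₀ t).hasDerivAt.hasDerivWithinAt (s := Icc t₀ T)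
  rw [hE t ht] at h
  refine h.congr_of_mem (fun x hx => ?_) ht
  refine intervalIntegral.integral_congr fun s hs => ?_
  rw [uIcc_of_le hx.1] at hs
  exact (hE s ⟨hs.1, hs.2.trans hx.2⟩).symm

/-- Integrating factor for the linear equation `u' = -h - D u`. -/
lemma hasDerivWithinAt_exp_integral_mul {D h u : ℝ → ℝ} {t₀ T t : ℝ} (hT : t₀ ≤ T)
    (hD : ContinuousOn D (Icc t₀ T)) (ht : t ∈ Icc t₀ T)
    (hu : HasDerivWithinAt u (-h t - D t * u t) (Icc t₀ T) t) :
    HasDerivWithinAt (fun x => Real.exp (∫ s in t₀..x, D s) * u x)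
      (-(Real.exp (∫ s in t₀..t, D s) * h t)) (Icc t₀ T) t := by
  refine ((hasDerivWithinAt_integral_Icc hT hD ht).exp.mul hu).congr_deriv ?_
  ring

lemma eq_exp_neg_integral_mul {D u : ℝ → ℝ} {t₀ T : ℝ} (hT : t₀ ≤ T)
    (hD : ContinuousOn D (Icc t₀ T))
    (hu : ∀ t ∈ Icc t₀ T, HasDerivWithinAt u (-(D t * u t)) (Icc t₀ T) t) :
    ∀ t ∈ Icc t₀ T, Real.exp (∫ s in t₀..t, D s) * u t = u t₀ := by
  have h : ∀ t ∈ Icc t₀ T, HasDerivWithinAt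
      (fun x => Real.exp (∫ s in t₀..x, D s) * u x) 0 (Icc t₀ T) t := fun t ht =>
    (hasDerivWithinAt_exp_integral_mul (h := 0) hT hD ht
      ((hu t ht).congr_deriv (by simp))).congr_deriv (by simp)
  intro t ht
  have := constant_of_has_deriv_right_zero (fun t ht => (h t ht).continuousWithinAt)
    (fun t ht => hasDerivWithinAt_Ici_of_Icc ht (h t (Ico_subset_Icc_self ht))) t ht
  simpa using this

/-! ### The truncated equation -/

/-- Truncation of `y` to the interval `[-1, M]`. -/
noncomputable def clamp (M y : ℝ) : ℝ := max (-1) (min M y)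

lemma clamp_of_mem {M y : ℝ} (h1 : -1 ≤ y) (h2 : y ≤ M) : clamp M y = y := by
  simp [clamp, h1, h2]

lemma clamp_of_le {M y : ℝ} (hM : 0 ≤ M) (h : M ≤ y) : clamp M y = M := by
  have : -1 ≤ M := by linarith
  simp [clamp, h, this]

lemma abs_clamp_le {M : ℝ} (hM : 1 ≤ M) (y : ℝ) : |clamp M y| ≤ M := by
  rw [abs_le, clamp]
  exact ⟨by linarith [le_max_left (-1) (min M y)], max_le (by linarith) (min_le_left _ _)⟩

lemma abs_clamp_sub_le (M x y : ℝ) : |clamp M x - clamp M y| ≤ |x - y| := by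
  refine (abs_max_sub_max_le_max _ _ _ _).trans (max_le (by simp) ?_)
  exact (abs_min_sub_min_le_max _ _ _ _).trans (max_le (by simp) le_rfl)

/-- The truncated field is bounded and Lipschitz in `y`, so its solutions are global on `[t₀, T]`
and depend continuously on the initial value. -/
lemma exists_clamped_flow (n : ℕ) {b : ℕ → ℝ → ℝ} {t₀ T M : ℝ} (hT : t₀ ≤ T) (hM : 1 ≤ M)
    (hb : ∀ k, Continuous (b k)) :
    ∃ α : ℝ → ℝ → ℝ, (∀ x ∈ Icc 0 M, α x t₀ = x ∧ ∀ t ∈ Icc t₀ T,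
      HasDerivWithinAt (α x) (-∑ k ∈ Finset.range (n + 1), b k t * clamp M (α x t) ^ k)
        (Icc t₀ T) t) ∧ ContinuousOn (fun x => α x T) (Icc 0 M) := by
  have hB : ∀ k, ∃ B, ∀ t ∈ Icc t₀ T, |b k t| ≤ B := fun k =>
    isCompact_Icc.exists_bound_of_continuousOn (hb k).continuousOn
  choose B hB using hB
  have hB0 : ∀ k, 0 ≤ B k := fun k => (abs_nonneg _).trans (hB k t₀ ⟨le_rfl, hT⟩)
  have hM0 : 0 ≤ M := by linarith
  set L : NNReal := ⟨∑ k ∈ Finset.range (n + 1), B k * M ^ k,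
    Finset.sum_nonneg fun k _ => mul_nonneg (hB0 k) (by positivity)⟩ with hL
  set K : NNReal := ⟨∑ k ∈ Finset.range (n + 1), B k * (k * M ^ (k - 1)),
    Finset.sum_nonneg fun k _ => mul_nonneg (hB0 k) (by positivity)⟩ with hK
  set τ : NNReal := ⟨T - t₀, by linarith⟩ with hτ
  set r : NNReal := ⟨M, hM0⟩ with hr
  have hPL : IsPicardLindelof
      (fun t y => -∑ k ∈ Finset.range (n + 1), b k t * clamp M y ^ k)
      (⟨t₀, le_rfl, hT⟩ : Icc t₀ T) 0 (L * τ + r) r L K := by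
    refine ⟨fun t ht => ?_, fun x _ => ?_, fun t ht x _ => ?_, ?_⟩
    · refine LipschitzOnWith.of_dist_le_mul fun x _ y _ => ?_
      rw [Real.dist_eq, Real.dist_eq, neg_sub_neg, ← Finset.sum_sub_distrib]
      refine (Finset.abs_sum_le_sum_abs _ _).trans ?_
      change _ ≤ (∑ k ∈ Finset.range (n + 1), B k * (k * M ^ (k - 1))) * _
      rw [Finset.sum_mul]
      refine Finset.sum_le_sum fun k _ => ?_
      rw [← mul_sub, abs_mul, mul_assoc]
      refine mul_le_mul (hB k t ht) ?_ (abs_nonneg _) (hB0 k)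
      calc |clamp M y ^ k - clamp M x ^ k|
          ≤ |clamp M y - clamp M x| * k * max |clamp M y| |clamp M x| ^ (k - 1) :=
            abs_pow_sub_pow_le ..
        _ ≤ |x - y| * k * M ^ (k - 1) := by
            rw [abs_sub_comm x y]
            have h1 := abs_clamp_sub_le M y x
            have h2 := max_le (abs_clamp_le hM y) (abs_clamp_le hM x)
            gcongr
        _ = k * M ^ (k - 1) * |x - y| := by ring
    · exact (continuous_neg.comp (continuous_finsetSum _ fun k _ =>
        (hb k).mul continuous_const)).continuousOn
    · rw [norm_neg]
      refine (Finset.abs_sum_le_sum_abs _ _).trans (Finset.sum_le_sum fun k _ => ?_)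
      rw [abs_mul, abs_pow]
      exact mul_le_mul (hB k t ht) (pow_le_pow_left₀ (abs_nonneg _) (abs_clamp_le hM _) k)
        (by positivity) (hB0 k)
    · have : L * max (T - t₀) (t₀ - t₀) ≤ (L * (T - t₀) + M) - M := by simp [hT]
      exact this
  obtain ⟨α, hα, L', hL'⟩ :=
    hPL.exists_forall_mem_closedBall_eq_hasDerivWithinAt_lipschitzOnWith
  have hsub : Icc 0 M ⊆ Metric.closedBall (0 : ℝ) r := fun x hx => by
    rw [mem_closedBall_zero_iff, Real.norm_eq_abs, abs_of_nonneg hx.1]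
    exact hx.2
  exact ⟨α, fun x hx => hα x (hsub hx),
    ((hL' T ⟨hT, le_rfl⟩).continuousOn).mono hsub⟩

/-- If the field points down along `y = M`, truncated solutions starting below `M` stay below. -/
lemma clamped_le (n : ℕ) {b : ℕ → ℝ → ℝ} {t₀ T M : ℝ} {y : ℝ → ℝ} (hT : t₀ < T) (hM : 0 ≤ M)
    (hup : ∀ t ∈ Icc t₀ T, 0 ≤ ∑ k ∈ Finset.range (n + 1), b k t * M ^ k)
    (hy : ∀ t ∈ Icc t₀ T, HasDerivWithinAt y
      (-∑ k ∈ Finset.range (n + 1), b k t * clamp M (y t) ^ k) (Icc t₀ T) t)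
    (hy0 : y t₀ ≤ M) : ∀ t ∈ Icc t₀ T, y t ≤ M := by
  intro t ht
  rw [← sub_nonpos]
  refine nonpos_of_forall_le_mul (K := T - t₀) (sub_pos.2 hT) one_pos fun ε hε _ => ?_
  have key := image_le_of_deriv_right_lt_deriv_boundary'
    (fun t ht => (hy t ht).continuousWithinAt)
    (fun t ht => hasDerivWithinAt_Ici_of_Icc ht (hy t (Ico_subset_Icc_self ht)))
    (B := fun t => M + ε * (t - t₀)) (B' := fun _ => ε) (by simpa using hy0) (by fun_prop)
    (fun t _ => by
      simpa using ((((hasDerivAt_id t).sub_const t₀).const_mul ε).const_add M).hasDerivWithinAt)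
    (fun t ht h => by
      have : 0 ≤ ε * (t - t₀) := mul_nonneg hε.le (sub_nonneg.2 ht.1)
      have hMy : M ≤ y t := by linarith
      have h0 := hup t (Ico_subset_Icc_self ht)
      rw [clamp_of_le hM hMy]
      linarith) ht
  have : ε * (t - t₀) ≤ ε * (T - t₀) := by gcongr; exact ht.2
  linarith

/-- The integrand of the weight `exp (∫ weightRate)`: an upper bound for
`∑_{k ≥ 1} b_k y ^ (k - 1)` on `0 ≤ y ≤ M`. -/
noncomputable def weightRate (n : ℕ) (b : ℕ → ℝ → ℝ) (M s : ℝ) : ℝ :=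
  (∑ k ∈ Finset.Icc 2 n, max 0 (b k s) * M ^ (k - 1)) + b 1 s

lemma continuous_weightRate (n : ℕ) {b : ℕ → ℝ → ℝ} (M : ℝ) (hb : ∀ k, Continuous (b k)) :
    Continuous (weightRate n b M) := by
  unfold weightRate
  fun_prop

lemma sum_range_eq_add_sum_Icc {n : ℕ} (hn : 1 ≤ n) (f : ℕ → ℝ) :
    ∑ k ∈ Finset.range (n + 1), f k = f 0 + f 1 + ∑ k ∈ Finset.Icc 2 n, f k := by
  rw [Finset.range_eq_Ico, Finset.sum_eq_sum_Ico_succ_bot (by omega),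
    Finset.sum_eq_sum_Ico_succ_bot (by omega), ← add_assoc]
  rfl

/-- With the weight `E = exp (∫ weightRate)`, the function `E y` dominates `-∫ E b₀` as long as
`0 ≤ y ≤ M`. Comparing `-∫ E b₀ - E y` with the small barriers `ε exp (C (t - t₀))` also controls
the solution while it is slightly negative, and thereby keeps it nonnegative. -/
lemma clamped_nonneg {n : ℕ} (hn : 1 ≤ n) {b : ℕ → ℝ → ℝ} {t₀ T M : ℝ} {y : ℝ → ℝ}
    (hT : t₀ < T) (hM : 1 ≤ M) (hb : ∀ k, Continuous (b k))
    (hint : ∀ t ∈ Icc t₀ T,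
      ∫ τ in t₀..t, Real.exp (∫ s in t₀..τ, weightRate n b M s) * b 0 τ ≤ 0)
    (hy : ∀ t ∈ Icc t₀ T, HasDerivWithinAt y
      (-∑ k ∈ Finset.range (n + 1), b k t * clamp M (y t) ^ k) (Icc t₀ T) t)
    (hyM : ∀ t ∈ Icc t₀ T, y t ≤ M) (hy0 : 0 ≤ y t₀) : ∀ t ∈ Icc t₀ T, 0 ≤ y t := by
  have hM0 : 0 ≤ M := by linarith
  have hg := continuous_weightRate n M hb
  set g := weightRate n b M with hgdef
  set E : ℝ → ℝ := fun t => Real.exp (∫ s in t₀..t, g s) with hE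
  have hEd : ∀ t, HasDerivAt E (E t * g t) t := fun t =>
    (hg.integral_hasStrictDerivAt t₀ t).hasDerivAt.exp
  have hEc : Continuous E := continuous_iff_continuousAt.2 fun t => (hEd t).continuousAt
  have hEpos : ∀ t, 0 < E t := fun t => Real.exp_pos _
  obtain ⟨m, hm, hmE⟩ : ∃ m > 0, ∀ t ∈ Icc t₀ T, m ≤ E t := by
    obtain ⟨s, -, hs⟩ := isCompact_Icc.exists_isMinOn (nonempty_Icc.2 hT.le) hEc.continuousOn
    exact ⟨E s, hEpos s, fun t ht => hs ht⟩
  obtain ⟨C, hC⟩ : ∃ C, ∀ t ∈ Icc t₀ T,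
      ‖∑ k ∈ Finset.Icc 2 n, (|b k t| + max 0 (b k t) * M ^ (k - 1))‖ ≤ C :=
    isCompact_Icc.exists_bound_of_continuousOn (by fun_prop)
  have hC0 : 0 ≤ C := (norm_nonneg _).trans (hC t₀ ⟨le_rfl, hT.le⟩)
  -- `F = A - E y` with `A = -∫ E b₀ ≥ 0`.
  set F : ℝ → ℝ := fun t => -(∫ τ in t₀..t, E τ * b 0 τ) - E t * y t with hF
  have hFd : ∀ t ∈ Icc t₀ T, HasDerivWithinAt F
      (-(E t * b 0 t) - (E t * g t * y t +
        E t * -∑ k ∈ Finset.range (n + 1), b k t * clamp M (y t) ^ k)) (Icc t₀ T) t :=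
    fun t ht => (((hEc.mul (hb 0)).integral_hasStrictDerivAt t₀ t).hasDerivAt.neg
      |>.hasDerivWithinAt).sub ((hEd t).hasDerivWithinAt.mul (hy t ht))
  intro t ht
  suffices h : F t ≤ 0 by
    have h1 := hint t ht
    have h2 : 0 ≤ E t * y t := by
      simp only [hF] at h
      linarith
    exact nonneg_of_mul_nonneg_right h2 (hEpos t)
  have hX : 0 < Real.exp ((C + 1) * (T - t₀)) := Real.exp_pos _
  refine nonpos_of_forall_le_mul hX (div_pos hm hX) fun ε hε hεm => ?_
  rw [le_div_iff₀ hX] at hεm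
  have hmono : ∀ s ∈ Icc t₀ T, ε * Real.exp ((C + 1) * (s - t₀)) ≤
      ε * Real.exp ((C + 1) * (T - t₀)) := fun s hs => by
    gcongr
    exact hs.2
  refine (image_le_of_deriv_right_lt_deriv_boundary'
    (B := fun s => ε * Real.exp ((C + 1) * (s - t₀)))
    (B' := fun s => ε * Real.exp ((C + 1) * (s - t₀)) * (C + 1))
    (fun t ht => (hFd t ht).continuousWithinAt)
    (fun t ht => hasDerivWithinAt_Ici_of_Icc ht (hFd t (Ico_subset_Icc_self ht)))
    ?_ (by fun_prop) (fun s _ => ?_) (fun s hs h => ?_) ht).trans (hmono t ht)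
  · have : E t₀ = 1 := by simp [hE]
    simp only [hF, this, intervalIntegral.integral_same]
    simp
    linarith
  · have := ((((hasDerivAt_id s).sub_const t₀).const_mul (C + 1)).exp).const_mul ε
    simpa [mul_assoc] using this.hasDerivWithinAt
  · have hs' := Ico_subset_Icc_self hs
    have hA := hint s hs'
    have hBpos : 0 < ε * Real.exp ((C + 1) * (s - t₀)) := mul_pos hε (Real.exp_pos _)
    have hBm := (hmono s hs').trans hεm
    set Bs := ε * Real.exp ((C + 1) * (s - t₀)) with hBs
    have hEy : -Bs ≤ E s * y s := by
      have : F s = Bs := h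
      simp only [hF] at this
      linarith
    have hEs := hEpos s
    -- `ε` is so small that the barrier stays below `min E`; hence `y` has not left `[-1, M]`.
    have hy1 : -1 ≤ y s := by
      have h1 := hmE s hs'
      by_contra! hlt
      nlinarith
    rw [clamp_of_mem hy1 (hyM s hs'), sum_range_eq_add_sum_Icc hn]
    have hsum : (∑ k ∈ Finset.Icc 2 n, b k s * y s ^ k) =
        y s * ∑ k ∈ Finset.Icc 2 n, b k s * y s ^ (k - 1) := by
      rw [Finset.mul_sum]
      refine Finset.sum_congr rfl fun k hk => ?_
      obtain ⟨l, rfl⟩ : ∃ l, k = l + 1 := ⟨k - 1, by have := Finset.mem_Icc.1 hk; omega⟩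
      simp only [Nat.add_sub_cancel]
      ring
    set q := ∑ k ∈ Finset.Icc 2 n, (b k s * y s ^ (k - 1) - max 0 (b k s) * M ^ (k - 1)) with hq
    have hval : -(E s * b 0 s) - (E s * g s * y s + E s * -(b 0 s * y s ^ 0 + b 1 s * y s ^ 1 +
        ∑ k ∈ Finset.Icc 2 n, b k s * y s ^ k)) = E s * y s * q := by
      rw [hsum, hq, Finset.sum_sub_distrib, hgdef, weightRate]
      ring
    rw [hval]
    -- For `y ≥ 0` the rate dominates, so `q ≤ 0`; for `-1 ≤ y < 0` only `|q| ≤ C` is available,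
    -- but then `|E y|` is at most the barrier, which grows at the faster rate `C + 1`.
    rcases le_or_gt 0 (y s) with hpos | hneg
    · have hq0 : q ≤ 0 := Finset.sum_nonpos fun k _ => by
        rw [sub_nonpos]
        have h1 : y s ^ (k - 1) ≤ M ^ (k - 1) := pow_le_pow_left₀ hpos (hyM s hs') _
        have h2 : 0 ≤ y s ^ (k - 1) := by positivity
        exact (mul_le_mul_of_nonneg_right (le_max_right 0 _) h2).trans
          (mul_le_mul_of_nonneg_left h1 (le_max_left _ _))
      have : E s * y s * q ≤ 0 := mul_nonpos_of_nonneg_of_nonpos (by positivity) hq0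
      have : 0 < Bs * (C + 1) := by positivity
      linarith
    · have hqC : |q| ≤ C := by
        refine (Finset.abs_sum_le_sum_abs _ _).trans
          (le_trans (Finset.sum_le_sum fun k _ => ?_) ((le_abs_self _).trans (hC s hs')))
        have hy1' : |y s| ≤ 1 := abs_le.2 ⟨hy1, by linarith⟩
        have h1 : |b k s * y s ^ (k - 1)| ≤ |b k s| := by
          rw [abs_mul, abs_pow]
          exact mul_le_of_le_one_right (abs_nonneg _) (pow_le_one₀ (abs_nonneg _) hy1')
        have h2 : |max 0 (b k s) * M ^ (k - 1)| = max 0 (b k s) * M ^ (k - 1) :=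
          abs_of_nonneg (mul_nonneg (le_max_left _ _) (by positivity))
        exact (abs_sub _ _).trans (by rw [h2]; linarith)
      have hEyneg : E s * y s < 0 := mul_neg_of_pos_of_neg hEs hneg
      have := (abs_le.1 hqC).1
      nlinarith

/-- The Poincaré map of the truncated equation maps `[0, M]` continuously to itself. Its fixed
point starts a closed solution that never meets the truncation. -/
lemma exists_closed_nonneg {n : ℕ} (hn : 1 ≤ n) {b : ℕ → ℝ → ℝ} {t₀ T M : ℝ}
    (hT : t₀ < T) (hM : 1 ≤ M) (hb : ∀ k, Continuous (b k))
    (hup : ∀ t ∈ Icc t₀ T, 0 ≤ ∑ k ∈ Finset.range (n + 1), b k t * M ^ k)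
    (hint : ∀ t ∈ Icc t₀ T,
      ∫ τ in t₀..t, Real.exp (∫ s in t₀..τ, weightRate n b M s) * b 0 τ ≤ 0) :
    ∃ y, IsClosedSolution n b t₀ T y ∧ ∀ t ∈ Icc t₀ T, 0 ≤ y t := by
  have hM0 : 0 ≤ M := by linarith
  obtain ⟨α, hα, hαc⟩ := exists_clamped_flow n hT.le hM hb
  have hle : ∀ x ∈ Icc 0 M, ∀ t ∈ Icc t₀ T, α x t ≤ M := fun x hx =>
    clamped_le n hT hM0 hup (hα x hx).2 ((hα x hx).1.trans_le hx.2)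
  have hnn : ∀ x ∈ Icc 0 M, ∀ t ∈ Icc t₀ T, 0 ≤ α x t := fun x hx =>
    clamped_nonneg hn hT hM hb hint (hα x hx).2 (hle x hx) (hx.1.trans_eq (hα x hx).1.symm)
  have hTm : T ∈ Icc t₀ T := ⟨hT.le, le_rfl⟩
  obtain ⟨x, hx, hfix⟩ := exists_mem_Icc_isFixedPt_of_mapsTo hαc hM0
    fun x hx => ⟨hnn x hx T hTm, hle x hx T hTm⟩
  refine ⟨α x, ⟨fun t ht => ?_, (hα x hx).1.trans hfix.symm⟩, hnn x hx⟩
  have h := (hα x hx).2 t ht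
  rwa [clamp_of_mem (by linarith [hnn x hx t ht]) (hle x hx t ht)] at h

/-! ### Positivity and isolation of closed solutions -/

/-- If `a₀ ≤ 0` and a nonnegative closed solution vanishes somewhere, then the integrating factor
makes it vanish from `t₀` on; being closed, it then vanishes identically, and so does `a₀`. -/
lemma IsClosedSolution.pos {n : ℕ} {b : ℕ → ℝ → ℝ} {t₀ T : ℝ} {y : ℝ → ℝ} (hT : t₀ < T)
    (hb : ∀ k ≤ n, ContinuousOn (b k) (Icc t₀ T)) (hy : IsClosedSolution n b t₀ T y)
    (hnn : ∀ t ∈ Icc t₀ T, 0 ≤ y t) (hne : ∃ t ∈ Icc t₀ T, b 0 t ≠ 0)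
    (hneg : ∀ t ∈ Icc t₀ T, b 0 t ≤ 0) : ∀ t ∈ Icc t₀ T, 0 < y t := by
  obtain ⟨hsol, hcl⟩ := hy
  have hyc : ContinuousOn y (Icc t₀ T) := fun t ht => (hsol t ht).continuousWithinAt
  set D : ℝ → ℝ := fun t => ∑ k ∈ Finset.range n, b (k + 1) t * y t ^ k with hDdef
  have hD : ContinuousOn D (Icc t₀ T) := continuousOn_finsetSum _ fun k hk =>
    (hb (k + 1) (by have := Finset.mem_range.1 hk; omega)).mul (hyc.pow k)
  have hrhs : ∀ t, -∑ k ∈ Finset.range (n + 1), b k t * y t ^ k = -b 0 t - D t * y t := by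
    intro t
    rw [Finset.sum_range_succ', hDdef, Finset.sum_mul]
    simp only [pow_succ, mul_assoc, pow_zero, mul_one]
    ring
  have hder : ∀ t ∈ Icc t₀ T, HasDerivWithinAt
      (fun x => Real.exp (∫ s in t₀..x, D s) * y x)
      (-(Real.exp (∫ s in t₀..t, D s) * b 0 t)) (Icc t₀ T) t := fun t ht =>
    hasDerivWithinAt_exp_integral_mul hT.le hD ht ((hsol t ht).congr_deriv (hrhs t))
  have hmono : MonotoneOn (fun x => Real.exp (∫ s in t₀..x, D s) * y x) (Icc t₀ T) :=
    monotoneOn_of_hasDerivWithinAt_nonneg (convex_Icc _ _)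
      (fun t ht => (hder t ht).continuousWithinAt)
      (fun t ht => (hder t (interior_subset ht)).mono interior_subset)
      (fun t ht => neg_nonneg.2 (mul_nonpos_of_nonneg_of_nonpos (Real.exp_pos _).le
        (hneg t (interior_subset ht))))
  have hzero : ∀ t ∈ Icc t₀ T, y t = 0 → ∀ s ∈ Icc t₀ t, y s = 0 := by
    intro t ht h0 s hs
    have hs' : s ∈ Icc t₀ T := ⟨hs.1, hs.2.trans ht.2⟩
    have h1 := hmono hs' ht hs.2
    simp only [h0, mul_zero] at h1
    exact le_antisymm (nonpos_of_mul_nonpos_right h1 (Real.exp_pos _)) (hnn s hs')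
  intro t ht
  refine (hnn t ht).lt_of_ne' fun h0 => ?_
  have hy0 : y t₀ = 0 := hzero t ht h0 t₀ ⟨le_rfl, ht.1⟩
  have hall := hzero T ⟨hT.le, le_rfl⟩ (hcl ▸ hy0)
  obtain ⟨s, hs, hbs⟩ := hne
  have h1 := hsol s hs
  rw [hrhs, hall s hs, mul_zero, sub_zero] at h1
  have h2 : HasDerivWithinAt y 0 (Icc t₀ T) s :=
    (hasDerivWithinAt_const s _ 0).congr_of_mem hall hs
  exact hbs (neg_eq_zero.1 ((uniqueDiffOn_Icc hT s hs).eq_deriv _ h1 h2))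

/-- The difference quotient of `∑ b_k y ^ k` between `y` and `y + u`; at `u = 0` it is the
coefficient of the variational equation. -/
def slopeCoeff (n : ℕ) (b : ℕ → ℝ → ℝ) (t y u : ℝ) : ℝ :=
  ∑ k ∈ Finset.range (n + 1), b k t * ∑ i ∈ Finset.range k, (y + u) ^ i * y ^ (k - 1 - i)

lemma slopeCoeff_mul (n : ℕ) (b : ℕ → ℝ → ℝ) (t y z : ℝ) :
    slopeCoeff n b t y (z - y) * (z - y) = ∑ k ∈ Finset.range (n + 1), b k t * z ^ k -
      ∑ k ∈ Finset.range (n + 1), b k t * y ^ k := by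
  rw [slopeCoeff, ← Finset.sum_sub_distrib, Finset.sum_mul]
  refine Finset.sum_congr rfl fun k _ => ?_
  have := (Commute.all z y).geom_sum₂_mul k
  rw [add_sub_cancel, mul_assoc, this]
  ring

lemma continuousOn_slopeCoeff {n : ℕ} {b : ℕ → ℝ → ℝ} {X : Type*}
    [TopologicalSpace X] {S : Set X} {τ v w : X → ℝ}
    (hb : ∀ k ≤ n, ContinuousOn (fun x => b k (τ x)) S) (hv : ContinuousOn v S)
    (hw : ContinuousOn w S) : ContinuousOn (fun x => slopeCoeff n b (τ x) (v x) (w x)) S :=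
  continuousOn_finsetSum _ fun k hk =>
    (hb k (Nat.lt_succ_iff.1 (Finset.mem_range.1 hk))).mul (by fun_prop)

/-- A closed solution is isolated if the coefficient of its variational equation has positive
integral: solutions starting nearby stay nearby, so their difference to `y` solves a linear
equation with coefficient of positive integral, and cannot be closed unless it vanishes. -/
lemma IsClosedSolution.isolated {n : ℕ} {b : ℕ → ℝ → ℝ} {t₀ T : ℝ} {y : ℝ → ℝ} (hT : t₀ < T)
    (hb : ∀ k ≤ n, ContinuousOn (b k) (Icc t₀ T)) (hy : IsClosedSolution n b t₀ T y)
    (hpos : 0 < ∫ t in t₀..T, slopeCoeff n b t (y t) 0) :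
    IsIsolatedClosedSolution n b t₀ T y := by
  refine ⟨hy, ?_⟩
  obtain ⟨hsol, hcl⟩ := hy
  have hyc : ContinuousOn y (Icc t₀ T) := fun t ht => (hsol t ht).continuousWithinAt
  have hTm : T ∈ Icc t₀ T := ⟨hT.le, le_rfl⟩
  have ht₀m : t₀ ∈ Icc t₀ T := ⟨le_rfl, hT.le⟩
  have hτ : MapsTo Prod.fst (Icc t₀ T ×ˢ Icc (-1 : ℝ) 1) (Icc t₀ T) := fun p hp => hp.1
  have hcont : ContinuousOn (fun p : ℝ × ℝ => slopeCoeff n b p.1 (y p.1) p.2)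
      (Icc t₀ T ×ˢ Icc (-1) 1) :=
    continuousOn_slopeCoeff (fun k hk => (hb k hk).comp continuousOn_fst hτ)
      (hyc.comp continuousOn_fst hτ) continuousOn_snd
  have hcpt : IsCompact (Icc t₀ T ×ˢ Icc (-1 : ℝ) 1) := isCompact_Icc.prod isCompact_Icc
  obtain ⟨C, hC⟩ := hcpt.exists_bound_of_continuousOn hcont
  have hC0 : 0 ≤ C := (norm_nonneg _).trans (hC (t₀, 0) ⟨ht₀m, by norm_num, by norm_num⟩)
  set I := ∫ t in t₀..T, slopeCoeff n b t (y t) 0 with hI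
  -- Perturbing the coefficient by at most `η` changes its integral by at most half of `I`.
  set η := I / (2 * (T - t₀)) with hη
  have hTt : 0 < T - t₀ := sub_pos.2 hT
  have hη0 : 0 < η := by positivity
  obtain ⟨δ, hδ, hunif⟩ := Metric.uniformContinuousOn_iff.1
    (hcpt.uniformContinuousOn_of_continuous hcont) η hη0
  set X := Real.exp ((C + 1) * (T - t₀)) with hX
  have hX0 : 0 < X := Real.exp_pos _
  set ρ := min 1 (δ / 2) with hρ
  have hρ0 : 0 < ρ := by positivity
  refine ⟨ρ / X, by positivity, fun z hz hclose => ?_⟩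
  obtain ⟨hzsol, hzcl⟩ := hz
  set u : ℝ → ℝ := fun t => z t - y t with hu
  have hud : ∀ t ∈ Icc t₀ T,
      HasDerivWithinAt u (-(slopeCoeff n b t (y t) (u t) * u t)) (Icc t₀ T) t := fun t ht => by
    refine ((hzsol t ht).sub (hsol t ht)).congr_deriv ?_
    rw [hu, slopeCoeff_mul]
    ring
  have huc : ContinuousOn u (Icc t₀ T) := fun t ht => (hud t ht).continuousWithinAt
  set ε := ρ / X with hε
  have hε0 : 0 < ε := by positivity
  have hεX : ε * X = ρ := div_mul_cancel₀ _ hX0.ne'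
  -- The barrier `|u| ≤ ε exp ((C + 1) (t - t₀)) ≤ ρ` is proved for `u ^ 2`, which is smooth in `u`.
  -- Here `|u| ≤ 1` is only needed, and known, at times where `|u|` meets the barrier.
  have hbar : ∀ t ∈ Icc t₀ T, ε * Real.exp ((C + 1) * (t - t₀)) ≤ ρ := fun t ht => by
    rw [← hεX, hX]
    gcongr
    exact ht.2
  have hsmall : ∀ t ∈ Icc t₀ T, |u t| ≤ ρ := by
    intro t ht
    have key := image_le_of_deriv_right_lt_deriv_boundary'
      (f := fun s => u s ^ 2) (f' := fun s => 2 * u s * -(slopeCoeff n b s (y s) (u s) * u s))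
      (B := fun s => (ε * Real.exp ((C + 1) * (s - t₀))) ^ 2)
      (B' := fun s => 2 * (ε * Real.exp ((C + 1) * (s - t₀))) *
        (ε * Real.exp ((C + 1) * (s - t₀)) * (C + 1)))
      (huc.pow 2)
      (fun s hs => hasDerivWithinAt_Ici_of_Icc hs
        (((hud s (Ico_subset_Icc_self hs)).pow 2).congr_deriv (by simp)))
      (by
        simp only [sub_self, mul_zero, Real.exp_zero, mul_one]
        exact sq_le_sq' (abs_lt.1 hclose).1.le (abs_lt.1 hclose).2.le)
      (by fun_prop)
      (fun s _ => by
        have := (((((hasDerivAt_id s).sub_const t₀).const_mul (C + 1)).exp).const_mul ε).pow 2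
        exact this.hasDerivWithinAt.congr_deriv (by simp [mul_assoc]))
      (fun s hs h => by
        have hs' := Ico_subset_Icc_self hs
        have hB0 : 0 < ε * Real.exp ((C + 1) * (s - t₀)) := mul_pos hε0 (Real.exp_pos _)
        have hBρ := hbar s hs'
        set Bs := ε * Real.exp ((C + 1) * (s - t₀)) with hBs
        have h' : u s ^ 2 = Bs ^ 2 := h
        have hus : |u s| ≤ 1 := by
          rw [(sq_eq_sq_iff_abs_eq_abs _ _).1 h', abs_of_pos hB0]
          exact hBρ.trans (min_le_left _ _)
        have hK := (abs_le.1 (hC (s, u s) ⟨hs', abs_le.1 hus⟩)).1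
        simp only at hK
        have hBsq : 0 < Bs ^ 2 := by positivity
        calc 2 * u s * -(slopeCoeff n b s (y s) (u s) * u s)
            = 2 * -slopeCoeff n b s (y s) (u s) * u s ^ 2 := by ring
          _ = 2 * -slopeCoeff n b s (y s) (u s) * Bs ^ 2 := by rw [h']
          _ < 2 * (C + 1) * Bs ^ 2 := by gcongr; linarith
          _ = _ := by ring) ht
    have hB0 : 0 ≤ ε * Real.exp ((C + 1) * (t - t₀)) := by positivity
    exact (abs_le_of_sq_le_sq key hB0).trans (hbar t ht)
  set D : ℝ → ℝ := fun t => slopeCoeff n b t (y t) (u t) with hD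
  have hDc : ContinuousOn D (Icc t₀ T) :=
    continuousOn_slopeCoeff (τ := fun t => t) hb hyc huc
  have hD0c : ContinuousOn (fun t => slopeCoeff n b t (y t) 0) (Icc t₀ T) :=
    continuousOn_slopeCoeff (τ := fun t => t) hb hyc continuousOn_const
  have hle : ∀ t ∈ Icc t₀ T, slopeCoeff n b t (y t) 0 - η ≤ D t := by
    intro t ht
    have h1 := hsmall t ht
    have h2 : |u t| ≤ 1 := h1.trans (min_le_left _ _)
    have h3 : |u t| < δ := (h1.trans (min_le_right _ _)).trans_lt (by linarith)
    have h4 := hunif (t, u t) ⟨ht, abs_le.1 h2⟩ (t, 0) ⟨ht, by norm_num, by norm_num⟩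
      (by simpa [Prod.dist_eq] using h3)
    rw [Real.dist_eq] at h4
    have := (abs_lt.1 h4).1
    simp only at this
    simp only [hD]
    linarith
  have hDpos : 0 < ∫ t in t₀..T, D t := by
    have h1 : ∫ t in t₀..T, (slopeCoeff n b t (y t) 0 - η) ≤ ∫ t in t₀..T, D t :=
      intervalIntegral.integral_mono_on hT.le
        ((hD0c.sub continuousOn_const).intervalIntegrable_of_Icc hT.le)
        (hDc.intervalIntegrable_of_Icc hT.le) hle
    rw [intervalIntegral.integral_sub (hD0c.intervalIntegrable_of_Icc hT.le)
      intervalIntegrable_const, ← hI, intervalIntegral.integral_const, smul_eq_mul] at h1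
    have h2 : (T - t₀) * η = I / 2 := by rw [hη]; field_simp
    linarith
  have hlin := eq_exp_neg_integral_mul hT.le hDc hud
  have huT : u T = u t₀ := by simp only [hu]; rw [← hzcl, ← hcl]
  have hu0 : u t₀ = 0 := by
    have h1 := hlin T hTm
    rw [huT] at h1
    have h2 : 1 < Real.exp (∫ s in t₀..T, D s) := Real.one_lt_exp_iff.2 hDpos
    by_contra hne
    exact h2.ne' (mul_right_cancel₀ hne (h1.trans (one_mul _).symm))
  intro t ht
  have h1 := hlin t ht
  rw [hu0] at h1
  exact sub_eq_zero.1 ((mul_eq_zero.1 h1).resolve_left (Real.exp_pos _).ne')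

/-! ### The bound `M` and the extension of the coefficients -/

lemma sum_abs_le_mul_of_boundM_le {n j : ℕ} {a : ℕ → ℝ → ℝ} {t₀ T M : ℝ} (hjn : j ≤ n)
    (hcont : ∀ k ≤ n, ContinuousOn (a k) (Icc t₀ T))
    (hpos : ∀ t ∈ Icc t₀ T, 0 < ∑ k ∈ Finset.Icc j n, a k t)
    (hM : boundM n a t₀ T j ≤ M) {t : ℝ} (ht : t ∈ Icc t₀ T) :
    ∑ k ∈ Finset.range j, |a k t| ≤ M * ∑ k ∈ Finset.Icc j n, a k t := by
  rw [← div_le_iff₀ (hpos t ht)]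
  refine le_trans ?_ ((le_max_right _ _).trans hM)
  refine le_csSup ?_
    (mem_image_of_mem (fun τ => (∑ k ∈ Finset.range j, |a k τ|) / ∑ k ∈ Finset.Icc j n, a k τ) ht)
  refine (isCompact_Icc.image_of_continuousOn (ContinuousOn.div ?_ ?_ fun t ht =>
    (hpos t ht).ne')).bddAbove
  · exact continuousOn_finsetSum _ fun k hk =>
      (hcont k (by have := Finset.mem_range.1 hk; omega)).abs
  · exact continuousOn_finsetSum _ fun k hk => hcont k (Finset.mem_Icc.1 hk).2

lemma sum_mul_pow_nonneg {n j : ℕ} (hj : 1 ≤ j) (hjn : j ≤ n) {c : ℕ → ℝ} {M : ℝ} (hM : 1 ≤ M)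
    (hc : ∀ k ∈ Finset.Icc j n, 0 ≤ c k)
    (h : ∑ k ∈ Finset.range j, |c k| ≤ M * ∑ k ∈ Finset.Icc j n, c k) :
    0 ≤ ∑ k ∈ Finset.range (n + 1), c k * M ^ k := by
  have hM0 : 0 ≤ M := by linarith
  have hsplit : ∑ k ∈ Finset.range (n + 1), c k * M ^ k =
      ∑ k ∈ Finset.range j, c k * M ^ k + ∑ k ∈ Finset.Icc j n, c k * M ^ k := by
    rw [← Finset.sum_range_add_sum_Ico _ (by omega : j ≤ n + 1)]
    rfl
  have hlow : -(M ^ (j - 1) * ∑ k ∈ Finset.range j, |c k|) ≤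
      ∑ k ∈ Finset.range j, c k * M ^ k := by
    rw [Finset.mul_sum, ← Finset.sum_neg_distrib]
    refine Finset.sum_le_sum fun k hk => ?_
    have h1 : M ^ k ≤ M ^ (j - 1) :=
      pow_le_pow_right₀ hM (by have := Finset.mem_range.1 hk; omega)
    have h2 : M ^ k * |c k| ≤ M ^ (j - 1) * |c k| := by gcongr
    have h3 : M ^ k * -|c k| ≤ M ^ k * c k := by
      gcongr
      exact neg_abs_le _
    linarith
  have hhigh : M ^ (j - 1) * (M * ∑ k ∈ Finset.Icc j n, c k) ≤
      ∑ k ∈ Finset.Icc j n, c k * M ^ k := by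
    rw [← mul_assoc, ← pow_succ, Nat.sub_add_cancel hj, Finset.mul_sum]
    refine Finset.sum_le_sum fun k hk => ?_
    rw [mul_comm]
    exact mul_le_mul_of_nonneg_left (pow_le_pow_right₀ hM (Finset.mem_Icc.1 hk).1) (hc k hk)
  have := mul_le_mul_of_nonneg_left h (pow_nonneg hM0 (j - 1))
  linarith

/-- Extension of `a_0, …, a_n` from `[t₀, T]` to functions that are continuous on `ℝ`. -/
lemma exists_continuous_extension {n : ℕ} {a : ℕ → ℝ → ℝ} {t₀ T : ℝ} (hT : t₀ ≤ T)
    (hcont : ∀ k ≤ n, ContinuousOn (a k) (Icc t₀ T)) :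
    ∃ b : ℕ → ℝ → ℝ, (∀ k, Continuous (b k)) ∧ ∀ k ≤ n, ∀ t ∈ Icc t₀ T, b k t = a k t := by
  have h : ∀ k, ∃ f : ℝ → ℝ, Continuous f ∧ (k ≤ n → ∀ t ∈ Icc t₀ T, f t = a k t) := by
    -- Nothing is known about the coefficients of degree above `n`; they are replaced by `0`.
    intro k
    by_cases hk : k ≤ n
    · exact ⟨IccExtend hT ((Icc t₀ T).domRestrict (a k)), (hcont k hk).domRestrict.Icc_extend',
        fun _ t ht => by rw [IccExtend_of_mem _ _ ht, domRestrict_apply]⟩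
    · exact ⟨0, continuous_const, fun h => absurd h hk⟩
  choose b hb hba using h
  exact ⟨b, hb, hba⟩

lemma IsSolution.congr_coeff {n : ℕ} {a b : ℕ → ℝ → ℝ} {t₀ T : ℝ} {y : ℝ → ℝ}
    (hab : ∀ k ≤ n, ∀ t ∈ Icc t₀ T, b k t = a k t) (hy : IsSolution n b t₀ T y) :
    IsSolution n a t₀ T y := fun t ht => by
  refine (hy t ht).congr_deriv (congrArg Neg.neg (Finset.sum_congr rfl fun k hk => ?_))
  rw [hab k (Nat.lt_succ_iff.1 (Finset.mem_range.1 hk)) t ht]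

/-- At a nonnegative value, nonnegative coefficients of degree at least two only increase the
coefficient of the variational equation. -/
lemma le_slopeCoeff_zero {n : ℕ} (hn : 1 ≤ n) {a : ℕ → ℝ → ℝ} {t y : ℝ} (hy : 0 ≤ y)
    (ha : ∀ k ∈ Finset.Icc 2 n, 0 ≤ a k t) : a 1 t ≤ slopeCoeff n a t y 0 := by
  rw [slopeCoeff, sum_range_eq_add_sum_Icc hn]
  have : 0 ≤ ∑ k ∈ Finset.Icc 2 n,
      a k t * ∑ i ∈ Finset.range k, (y + 0) ^ i * y ^ (k - 1 - i) :=
    Finset.sum_nonneg fun k hk => mul_nonneg (ha k hk)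
      (Finset.sum_nonneg fun i _ => by positivity)
  simpa using this

end PolyODE

theorem theorem5p1 (n j : ℕ) (a : ℕ → ℝ → ℝ) (t₀ T M : ℝ)
    (hT : t₀ < T) (hj : 2 ≤ j) (hjn : j ≤ n)
    (hcont : ∀ k ≤ n, ContinuousOn (a k) (Set.Icc t₀ T))
    (hnonneg : ∀ k ∈ Finset.Icc j n, ∀ t ∈ Set.Icc t₀ T, 0 ≤ a k t)
    (hpos : ∀ t ∈ Set.Icc t₀ T, 0 < ∑ k ∈ Finset.Icc j n, a k t)
    (hM : PolyODE.boundM n a t₀ T j ≤ M)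
    (hint : ∀ t ∈ Set.Icc t₀ T,
      ∫ τ in t₀..t,
        Real.exp (∫ s in t₀..τ,
          ((∑ k ∈ Finset.Icc 2 n, max 0 (a k s) * M ^ (k - 1)) + a 1 s)) * a 0 τ ≤ 0) :
    ∃ y : ℝ → ℝ,
      (PolyODE.IsClosedSolution n a t₀ T y ∧ ∀ t ∈ Set.Icc t₀ T, 0 ≤ y t) ∧
      ((∃ t ∈ Set.Icc t₀ T, a 0 t ≠ 0) → (∀ t ∈ Set.Icc t₀ T, a 0 t ≤ 0) →
        ∀ t ∈ Set.Icc t₀ T, 0 < y t) ∧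
      (j = 2 → 0 < ∫ τ in t₀..T, a 1 τ →
        PolyODE.IsIsolatedClosedSolution n a t₀ T y) := by
  have hn : 1 ≤ n := by omega
  have hM1 : 1 ≤ M := (le_max_left _ _).trans hM
  obtain ⟨b, hb, hba⟩ := PolyODE.exists_continuous_extension hT.le hcont
  have hup : ∀ t ∈ Icc t₀ T, 0 ≤ ∑ k ∈ Finset.range (n + 1), b k t * M ^ k := fun t ht => by
    have h := PolyODE.sum_mul_pow_nonneg (by omega) hjn hM1 (fun k hk => hnonneg k hk t ht)
      (PolyODE.sum_abs_le_mul_of_boundM_le hjn hcont hpos hM ht)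
    refine h.trans_eq (Finset.sum_congr rfl fun k hk => ?_)
    rw [hba k (Nat.lt_succ_iff.1 (Finset.mem_range.1 hk)) t ht]
  have hintb : ∀ t ∈ Icc t₀ T, ∫ τ in t₀..t,
      Real.exp (∫ s in t₀..τ, PolyODE.weightRate n b M s) * b 0 τ ≤ 0 := fun t ht => by
    refine le_of_eq_of_le (intervalIntegral.integral_congr fun τ hτ => ?_) (hint t ht)
    rw [uIcc_of_le ht.1] at hτ
    have hτ' : τ ∈ Icc t₀ T := ⟨hτ.1, hτ.2.trans ht.2⟩
    rw [hba 0 (by omega) τ hτ']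
    congr 2
    refine intervalIntegral.integral_congr fun s hs => ?_
    rw [uIcc_of_le hτ.1] at hs
    have hs' : s ∈ Icc t₀ T := ⟨hs.1, hs.2.trans hτ'.2⟩
    simp only [PolyODE.weightRate]
    rw [hba 1 hn s hs']
    congr 1
    refine Finset.sum_congr rfl fun k hk => ?_
    rw [hba k (Finset.mem_Icc.1 hk).2 s hs']
  obtain ⟨y, ⟨hysol, hycl⟩, hynn⟩ := PolyODE.exists_closed_nonneg hn hT hM1 hb hup hintb
  have hy : PolyODE.IsClosedSolution n a t₀ T y := ⟨hysol.congr_coeff hba, hycl⟩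
  refine ⟨y, ⟨hy, hynn⟩, hy.pos hT hcont hynn, fun hj2 ha1 => hy.isolated hT hcont ?_⟩
  have hyc : ContinuousOn y (Icc t₀ T) := fun t ht => (hysol t ht).continuousWithinAt
  have hSc : ContinuousOn (fun t => PolyODE.slopeCoeff n a t (y t) 0) (Icc t₀ T) :=
    PolyODE.continuousOn_slopeCoeff (τ := fun t => t) hcont hyc
      continuousOn_const
  subst hj2
  exact ha1.trans_le (intervalIntegral.integral_mono_on hT.le
    ((hcont 1 hn).intervalIntegrable_of_Icc hT.le) (hSc.intervalIntegrable_of_Icc hT.le)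
    fun t ht => PolyODE.le_slopeCoeff_zero hn (hynn t ht) fun k hk => hnonneg k hk t ht)
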